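/- Let $u>0$, $T=[0,u]$, $d\in\mathbb N$, let $\lambda$ be Lebesgue measure, and let $M=(M_t)_{t\in T}$ be an $\mathbb R^d$-valued continuous local martingale with $M_0=0$, on a filtered probability space whose filtration contains all null sets. Assume that the matrix-valued covariation process $[M]$ is, up to indistinguishability, deterministic, and that $\operatorname{tr}[M]_u>0$. Let $\mu$ be the Lebesgue--Stieltjes measure on $T$ induced by $t\mapsto\operatorname{tr}[M]_t$, let $\pi:T\to\mathbb R^{d\times d}$ be measurable and $\mu$-integrable with $[M]_t=\int_{[0,t]}\pi\,\mathrm d\mu$ for all $t\in T$, and let $\mu_{i,i}$ be the measure induced by $[M^i]$, i.e. $\mathrm d\mu_{i,i}=\pi_{i,i}\,\mathrm d\mu$. Let $\Lambda^2$ be the space of all ($\mu$-a.e.) measurable $f:T\to\mathbb R^d$ with $$\|f\|_{\Lambda^2}:=\Bigl(\int_T f^\top\pi f\,\mathrm d\mu\Bigr)^{1/2}<\infty,$$ and let $\Lambda^{2,0}$ be the space of all ($\mu$-a.e.) measurable $f:T\to\mathbb R^d$ with $f_i\in L^2(\mu_{i,i})$ for $i=1,\dots,d$; in both spaces $f$ and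 $g$ are identified if $(f-g)^\top\pi(f-g)=0$ $\mu$-a.e., and both carry the norm $\|\cdot\|_{\Lambda^2}$. For $\psi:\mathbb R\to\mathbb R$ let $\mathcal{NN}^d_{1,\infty}(\psi)$ be the set of shallow feedforward networks, i.e. of all functions $T\ni t\mapsto\bigl(\sum_{k=1}^m w_{ik}\,\psi(\alpha_k t+\eta_k)+b_i\bigr)_{i=1}^d$ with $m\in\mathbb N$ and real $w_{ik},\alpha_k,\eta_k,b_i$. Assume that one of the following holds: 1. $\psi$ is continuous, bounded and nonconstant; 2. $\psi$ is essentially bounded on every compact subset of $\mathbb R$, the set of points of discontinuity of $\psi$ is a $\lambda$-null set, $\psi$ is not $\lambda$-a.e. equal to a polynomial on $\mathbb R$, and $\mu$ is absolutely continuous with respect to $\lambda$ restricted to $T$. Then $\mathcal{NN}^d_{1,\infty}(\psi)$ is a dense linear subspace of $\Lambda^{2,0}$, and also a dense linear subspace of $\Lambda^2$. -/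

import Mathlib

open MeasureTheory ProbabilityTheory Filter Topology

noncomputable section

/-- The compact time interval `T = [0, u]`. -/
abbrev TimeInterval (u : ℝ) : Type := Set.Icc (0 : ℝ) u

instance fact_le_of_fact_lt (u : ℝ) [h : Fact (0 < u)] : Fact ((0 : ℝ) ≤ u) := ⟨h.out.le⟩

/-! ### Continuous local martingales and their covariation -/

/-- `M` is an `ℝᵈ`-valued continuous local martingale on `[0, u]` with `M₀ = 0`. On a compact
time interval a localizing sequence is eventually equal to `⊤`, almost surely. -/
structure IsContinuousLocalMartingale {Ω : Type*} {mΩ : MeasurableSpace Ω} (P : Measure Ω)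
    {u : ℝ} [Fact (0 < u)] (ℱ : Filtration (TimeInterval u) mΩ) {d : ℕ}
    (M : TimeInterval u → Ω → EuclideanSpace ℝ (Fin d)) : Prop where
  adapted : StronglyAdapted ℱ M
  continuous_paths : ∀ᵐ ω ∂P, Continuous fun t => M t ω
  initial : ∀ᵐ ω ∂P, M ⊥ ω = 0
  locally_martingale : Locally (fun X => Martingale X ℱ P) ℱ M P

/-- `(m n, p n)` is a sequence of partitions `0 = p n 0 ≤ p n 1 ≤ ⋯ ≤ p n (m n) = t` of `[0, t]`
whose mesh tends to `0` as `n → ∞`. -/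
structure IsPartitionSequence {u : ℝ} [Fact (0 < u)] (t : TimeInterval u)
    (m : ℕ → ℕ) (p : ℕ → ℕ → TimeInterval u) : Prop where
  monotone : ∀ n, Monotone (p n)
  left : ∀ n, p n 0 = ⊥
  right : ∀ n, p n (m n) = t
  mesh : ∀ ε : ℝ, 0 < ε → ∀ᶠ n in atTop, ∀ k < m n, (p n (k + 1) : ℝ) - (p n k : ℝ) < ε

/-- `Q` is (a version of) the covariation process `[X, Y]` of two real continuous local
martingales: `Q` has continuous paths, starts at `0`, and, at each time `t`, is the limit in
probability of the sums of products of increments along partitions of `[0, t]` with mesh tending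
to `0`. -/
structure IsCovariation {Ω : Type*} {mΩ : MeasurableSpace Ω} (P : Measure Ω)
    {u : ℝ} [Fact (0 < u)] (X Y Q : TimeInterval u → Ω → ℝ) : Prop where
  continuous_paths : ∀ᵐ ω ∂P, Continuous fun t => Q t ω
  initial : ∀ᵐ ω ∂P, Q ⊥ ω = 0
  tendsto : ∀ (t : TimeInterval u) (m : ℕ → ℕ) (p : ℕ → ℕ → TimeInterval u),
    IsPartitionSequence t m p →
      TendstoInMeasure P
        (fun n ω => ∑ k ∈ Finset.range (m n),
          (X (p n (k + 1)) ω - X (p n k) ω) * (Y (p n (k + 1)) ω - Y (p n k) ω))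
        atTop (Q t)

/-- The matrix-valued covariation process `[M] = ([Mⁱ, Mʲ])ᵢⱼ` is (up to indistinguishability) the
deterministic function `A`. -/
def HasDeterministicCovariation {Ω : Type*} {mΩ : MeasurableSpace Ω} (P : Measure Ω)
    {u : ℝ} [Fact (0 < u)] {d : ℕ} (M : TimeInterval u → Ω → EuclideanSpace ℝ (Fin d))
    (A : TimeInterval u → Matrix (Fin d) (Fin d) ℝ) : Prop :=
  ∀ i j, IsCovariation P (fun t ω => M t ω i) (fun t ω => M t ω j) (fun t _ => A t i j)

/-- `μ` is the Lebesgue–Stieltjes measure on `[0, u]` induced by the increasing continuous function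
`F` with `F 0 = 0`: it is the unique Borel measure with `μ [0, t] = F t` for all `t`. -/
def IsLebesgueStieltjes {u : ℝ} (F : TimeInterval u → ℝ) (μ : Measure (TimeInterval u)) : Prop :=
  ∀ t, μ (Set.Iic t) = ENNReal.ofReal (F t)

/-- `π` is a (componentwise, measurable and integrable) density of `A` with respect to `μ`, that
is, `A t = ∫_{[0, t]} π dμ` for all `t ∈ [0, u]`. -/
structure IsCovariationDensity {u : ℝ} {d : ℕ} (A : TimeInterval u → Matrix (Fin d) (Fin d) ℝ)
    (μ : Measure (TimeInterval u)) (π : TimeInterval u → Matrix (Fin d) (Fin d) ℝ) : Prop where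
  measurable : ∀ i j, Measurable fun s => π s i j
  integrable : ∀ i j, Integrable (fun s => π s i j) μ
  eq_integral : ∀ t i j, A t i j = ∫ s in Set.Iic t, π s i j ∂μ

/-! ### The spaces `Λ²` and `Λ^{2,0}`

Both spaces are given through representatives: two functions `f`, `g` represent the same element
if `(f - g)ᵀ π (f - g) = 0` `μ`-a.e., that is, if `lambdaNorm π μ (f - g) = 0`. Since `μ`-a.e. equal
functions are identified, representatives are only asked to be `μ`-a.e. measurable. -/

/-- The seminorm `‖f‖ = (∫ fᵀ π f dμ)^{1/2} ∈ [0, ∞]`. -/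
def lambdaNorm {u : ℝ} {d : ℕ} (π : TimeInterval u → Matrix (Fin d) (Fin d) ℝ)
    (μ : Measure (TimeInterval u)) (f : TimeInterval u → EuclideanSpace ℝ (Fin d)) : ENNReal :=
  (∫⁻ s, ENNReal.ofReal (∑ i, ∑ j, f s i * π s i j * f s j) ∂μ) ^ (1 / 2 : ℝ)

/-- The (representatives of elements of the) space `Λ²`. -/
def Lambda2 {u : ℝ} {d : ℕ} (π : TimeInterval u → Matrix (Fin d) (Fin d) ℝ)
    (μ : Measure (TimeInterval u)) : Set (TimeInterval u → EuclideanSpace ℝ (Fin d)) :=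
  {f | AEMeasurable f μ ∧ lambdaNorm π μ f < ⊤}

/-- The measure `μᵢᵢ = πᵢᵢ · μ` induced by `[Mⁱ]`. -/
def diagMeasure {u : ℝ} {d : ℕ} (π : TimeInterval u → Matrix (Fin d) (Fin d) ℝ)
    (μ : Measure (TimeInterval u)) (i : Fin d) : Measure (TimeInterval u) :=
  μ.withDensity fun s => ENNReal.ofReal (π s i i)

/-- The (representatives of elements of the) space `Λ^{2,0}`. -/
def Lambda20 {u : ℝ} {d : ℕ} (π : TimeInterval u → Matrix (Fin d) (Fin d) ℝ)
    (μ : Measure (TimeInterval u)) : Set (TimeInterval u → EuclideanSpace ℝ (Fin d)) :=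
  {f | AEMeasurable f μ ∧ ∀ i, MemLp (fun s => f s i) 2 (diagMeasure π μ i)}

/-- `D` is a dense linear subspace of the linear space `V`, with respect to `lambdaNorm π μ`. -/
def IsDenseLinearSubspace {u : ℝ} {d : ℕ} (π : TimeInterval u → Matrix (Fin d) (Fin d) ℝ)
    (μ : Measure (TimeInterval u)) (D V : Set (TimeInterval u → EuclideanSpace ℝ (Fin d))) : Prop :=
  (∃ S W : Submodule ℝ (TimeInterval u → EuclideanSpace ℝ (Fin d)),
    (S : Set (TimeInterval u → EuclideanSpace ℝ (Fin d))) = D ∧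
    (W : Set (TimeInterval u → EuclideanSpace ℝ (Fin d))) = V ∧ S ≤ W) ∧
  ∀ f ∈ V, ∀ ε : ENNReal, 0 < ε → ∃ g ∈ D, lambdaNorm π μ (f - g) < ε

/-! ### Shallow feedforward networks -/

/-- The set of feedforward neural networks on `[0, u]` with one input neuron, one hidden layer with
an arbitrary finite number `m` of nodes with activation function `ψ`, and `d` output neurons with
identity activation function. -/
def shallowNetworks (u : ℝ) (d : ℕ) (ψ : ℝ → ℝ) :
    Set (TimeInterval u → EuclideanSpace ℝ (Fin d)) :=
  {f | ∃ (m : ℕ) (α η : Fin m → ℝ) (w : Matrix (Fin d) (Fin m) ℝ) (b : Fin d → ℝ),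
    ∀ (t : TimeInterval u) (i : Fin d), f t i = ∑ k, w i k * ψ (α k * (t : ℝ) + η k) + b i}

/-- `ψ` is continuous, bounded and nonconstant. -/
structure IsContinuousBoundedNonconstant (ψ : ℝ → ℝ) : Prop where
  continuous : Continuous ψ
  bounded : ∃ C, ∀ x, |ψ x| ≤ C
  nonconstant : ¬ ∃ c, ∀ x, ψ x = c

/-- `ψ` is locally essentially bounded, its set of points of discontinuity is a null set, and `ψ`
is not almost everywhere equal to a polynomial (all with respect to Lebesgue measure on `ℝ`). -/
structure IsLocallyBoundedNonpolynomial (ψ : ℝ → ℝ) : Prop where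
  locally_bounded : ∀ K : Set ℝ, IsCompact K → ∃ C : ℝ, ∀ᵐ x ∂(volume.restrict K), |ψ x| ≤ C
  ae_continuous : volume {x | ¬ ContinuousAt ψ x} = 0
  not_polynomial : ¬ ∃ q : Polynomial ℝ, ∀ᵐ x, ψ x = q.eval x

end

/-! The vector-valued problem reduces to scalar approximation in the spaces $L^2(\mu_{i,i})$. Sums
of squared increments show that $t\mapsto x^\top A_t x$ is increasing for each $x$, so $\pi$ is
positive semidefinite $\mu$-a.e. (`IsCovariationDensity.ae_quadForm_nonneg`). Positivity gives
$f^\top\pi f\le d\sum_i\pi_{i,i}f_i^2$, hence $\Lambda^{2,0}\subseteq\Lambda^2$, and it suffices to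
approximate each coordinate in $L^2(\mu_{i,i})$. An element of $\Lambda^2$ need not have coordinates
in these spaces, but its bounded truncations do, and they converge to it in $\Lambda^2$ by dominated
convergence.

The scalar case is a Hilbert space argument (`Lp_eq_zero_of_annihilates`). Let $h\in L^2(\nu)$ be
orthogonal to all networks. By Fubini $h$ also annihilates $g(\alpha t+\eta)$ for every
mollification $g$ of $\psi$. Differentiating $k$ times in $\alpha$ at $0$ gives $g^{(k)}(\eta)\int
h\,t^k\,\mathrm d\nu=0$ for all $\eta$. If some moment were nonzero, every mollification would be a
polynomial of degree less than $k$, and so would their a.e. limit $\psi$, which is excluded. So all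
moments vanish, and $h=0$ by Weierstrass. `HasRegularModification` lets this argument cover both
classes of activation functions. -/

open scoped Convolution

/-! ### Smooth functions with a vanishing derivative, and limits of polynomials -/

/-- Every real polynomial of degree `< k` has a primitive of degree `< k + 1`. -/
theorem Polynomial.exists_derivative_eq {k : ℕ} {q : Polynomial ℝ} (hq : q.degree < k) :
    ∃ Q : Polynomial ℝ, Q.degree < ((k + 1 : ℕ) : WithBot ℕ) ∧ Polynomial.derivative Q = q := by
  rcases eq_or_ne q 0 with rfl | h0
  · exact ⟨0, by simp, by simp⟩
  refine ⟨∑ i ∈ Finset.range k, Polynomial.C (q.coeff i / (i + 1)) * Polynomial.X ^ (i + 1), ?_, ?_⟩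
  · refine lt_of_le_of_lt (Polynomial.degree_sum_le _ _) ?_
    rw [Finset.sup_lt_iff (WithBot.bot_lt_coe _)]
    intro i hi
    refine lt_of_le_of_lt (Polynomial.degree_C_mul_X_pow_le _ _) ?_
    have := Finset.mem_range.1 hi
    exact_mod_cast Nat.succ_lt_succ this
  · rw [Polynomial.derivative_sum]
    conv_rhs => rw [Polynomial.as_sum_range' q k
      ((Polynomial.natDegree_lt_iff_degree_lt h0).2 hq)]
    refine Finset.sum_congr rfl fun i _ => ?_
    have h : ((i : ℝ) + 1) ≠ 0 := by positivity
    rw [Polynomial.derivative_C_mul_X_pow, Polynomial.C_mul_X_pow_eq_monomial]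
    congr 1
    push_cast
    field_simp

/-- A smooth function whose `k`-th derivative vanishes is a polynomial of degree `< k`. -/
theorem exists_polynomial_of_iteratedDeriv_eq_zero (k : ℕ) {g : ℝ → ℝ} (hg : ContDiff ℝ (⊤ : ℕ∞) g)
    (h : ∀ x, iteratedDeriv k g x = 0) :
    ∃ p : Polynomial ℝ, p.degree < k ∧ ∀ x, g x = p.eval x := by
  induction k generalizing g with
  | zero =>
    refine ⟨0, by simp, fun x => ?_⟩
    simpa using h x
  | succ k ih =>
    obtain ⟨q, hq, hgq⟩ := ih (g := deriv g) (contDiff_infty_iff_deriv.1 hg).2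
      (fun x => by rw [← iteratedDeriv_succ']; exact h x)
    obtain ⟨Q, hQ, hQq⟩ := Polynomial.exists_derivative_eq hq
    have hd : Differentiable ℝ g := hg.differentiable (by simp)
    have hconst : ∀ x y, (g x - Q.eval x) = (g y - Q.eval y) := by
      refine is_const_of_deriv_eq_zero (f := fun x => g x - Q.eval x) (hd.sub Q.differentiable)
        fun x => ?_
      rw [deriv_fun_sub (hd x) Q.differentiableAt, hgq, Polynomial.deriv, hQq, sub_self]
    refine ⟨Q + Polynomial.C (g 0 - Q.eval 0), ?_, fun x => ?_⟩
    · refine lt_of_le_of_lt (Polynomial.degree_add_le _ _) (max_lt hQ ?_)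
      refine lt_of_le_of_lt Polynomial.degree_C_le ?_
      exact_mod_cast Nat.succ_pos k
    · rw [Polynomial.eval_add, Polynomial.eval_C, ← hconst x 0]; ring

/-- An almost everywhere limit of polynomials of bounded degree is almost everywhere a
polynomial. -/
theorem exists_polynomial_of_ae_tendsto {k : ℕ} {p : ℕ → Polynomial ℝ} {f : ℝ → ℝ}
    (hp : ∀ n, (p n).degree < k)
    (hf : ∀ᵐ x, Tendsto (fun n => (p n).eval x) atTop (𝓝 (f x))) :
    ∃ q : Polynomial ℝ, ∀ᵐ x, f x = q.eval x := by
  have hinf : {x | Tendsto (fun n => (p n).eval x) atTop (𝓝 (f x))}.Infinite := by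
    intro hfin
    have h0 : volume {x | Tendsto (fun n => (p n).eval x) atTop (𝓝 (f x))} = 0 :=
      hfin.measure_zero _
    have h1 : volume (Set.univ : Set ℝ) = 0 := by
      rw [← Set.union_compl_self {x | Tendsto (fun n => (p n).eval x) atTop (𝓝 (f x))}]
      exact measure_union_null h0 hf
    simp at h1
  -- A polynomial of degree less than `k` is determined by its values at `k` nodes. With nodes
  -- chosen where the sequence converges, convergence of the values carries over to the Lagrange
  -- interpolants at every point.
  obtain ⟨s, hs, hcard⟩ := hinf.exists_subset_card_eq k
  refine ⟨Lagrange.interpolate s id f, ?_⟩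
  filter_upwards [hf] with x hx
  refine tendsto_nhds_unique hx ?_
  have hpn : ∀ n, (p n).eval x
      = ∑ i ∈ s, (p n).eval i * (Lagrange.basis s id i).eval x := by
    intro n
    conv_lhs => rw [Lagrange.eq_interpolate (f := p n) (s := s) (v := id) Function.injective_id.injOn
      (by rw [hcard]; exact hp n)]
    simp [Lagrange.interpolate_apply, Polynomial.eval_finsetSum]
  simp only [hpn, Lagrange.interpolate_apply, Polynomial.eval_finsetSum, Polynomial.eval_mul,
    Polynomial.eval_C]
  exact tendsto_finsetSum _ fun i hi => (hs hi).mul_const _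

/-! ### Functions annihilating all dilates and translates of an activation function -/

/-- Differentiating `∫ h(t) g(α t + η) dν(t) = 0` repeatedly in `α`. -/
theorem integral_pow_mul_iteratedDeriv_eq_zero {u : ℝ} {ν : Measure (TimeInterval u)}
    {h : TimeInterval u → ℝ} (hh : Integrable h ν) {g : ℝ → ℝ} (hg : ContDiff ℝ (⊤ : ℕ∞) g) (η : ℝ)
    (h0 : ∀ α : ℝ, ∫ t, h t * g (α * t + η) ∂ν = 0) (k : ℕ) (α : ℝ) :
    ∫ t, h t * ((t : ℝ) ^ k * iteratedDeriv k g (α * t + η)) ∂ν = 0 := by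
  have hcont : ∀ k, Continuous (iteratedDeriv k g) := fun k =>
    hg.continuous_iteratedDeriv k (by exact_mod_cast le_top)
  have hint : ∀ k (α : ℝ), Integrable
      (fun t : TimeInterval u => h t * ((t : ℝ) ^ k * iteratedDeriv k g (α * t + η))) ν := by
    intro k α
    have hc : Continuous fun t : TimeInterval u =>
        (t : ℝ) ^ k * iteratedDeriv k g (α * t + η) := by
      have := hcont k
      fun_prop
    obtain ⟨C, hC⟩ := isCompact_univ.exists_bound_of_continuousOn hc.continuousOn
    exact hh.mul_bdd hc.aestronglyMeasurable (ae_of_all _ fun t => hC t trivial)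
  induction k generalizing α with
  | zero => simpa using h0 α
  | succ k ih =>
    have hc : Continuous fun z : ℝ × TimeInterval u =>
        (z.2 : ℝ) ^ (k + 1) * iteratedDeriv (k + 1) g (z.1 * z.2 + η) := by
      have := hcont (k + 1)
      fun_prop
    -- Compactness in `α` and `t` jointly gives a bound uniform near `α`, as needed to differentiate
    -- under the integral.
    obtain ⟨C, hC⟩ := ((isCompact_closedBall α 1).prod
      (isCompact_univ (X := TimeInterval u))).exists_bound_of_continuousOn hc.continuousOn
    have hder := (hasDerivAt_integral_of_dominated_loc_of_deriv_le (μ := ν)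
      (F := fun (α : ℝ) (t : TimeInterval u) =>
        h t * ((t : ℝ) ^ k * iteratedDeriv k g (α * t + η)))
      (F' := fun (α : ℝ) (t : TimeInterval u) =>
        h t * ((t : ℝ) ^ (k + 1) * iteratedDeriv (k + 1) g (α * t + η)))
      (x₀ := α) (s := Metric.closedBall α 1) (bound := fun t => ‖h t‖ * C)
      (Metric.closedBall_mem_nhds α one_pos)
      (Eventually.of_forall fun β => (hint k β).aestronglyMeasurable) (hint k α)
      (hint (k + 1) α).aestronglyMeasurable
      (ae_of_all _ fun t β hβ => by
        rw [norm_mul]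
        exact mul_le_mul_of_nonneg_left (hC (β, t) ⟨hβ, trivial⟩) (norm_nonneg _))
      (hh.norm.mul_const C)
      (ae_of_all _ fun t β _ => by
        have hg' : HasDerivAt (iteratedDeriv k g) (iteratedDeriv (k + 1) g (β * t + η))
            (β * t + η) := by
          rw [iteratedDeriv_succ]
          exact (hg.differentiable_iteratedDeriv k
            (by exact_mod_cast WithTop.coe_lt_top _) _).hasDerivAt
        have hl : HasDerivAt (fun β : ℝ => β * (t : ℝ) + η) (t : ℝ) β := by
          simpa using ((hasDerivAt_id β).mul_const (t : ℝ)).add_const η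
        have := ((hg'.comp β hl).const_mul ((t : ℝ) ^ k)).const_mul (h t)
        refine this.congr_deriv ?_
        ring)).2
    -- The induction hypothesis holds for every `α`, so the differentiated function is identically
    -- zero.
    simp only [ih] at hder
    exact hder.unique (hasDerivAt_const α (0 : ℝ))

/-- If `h` annihilates all translates of `t ↦ ψ (α t)`, then it annihilates all translates of
`t ↦ (φ ⋆ ψ) (α t)`. -/
theorem integral_mul_convolution_eq_zero {u : ℝ} {ν : Measure (TimeInterval u)} [SFinite ν]
    {h : TimeInterval u → ℝ} (hh : Integrable h ν) {ψ φ : ℝ → ℝ} (hψ : Measurable ψ)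
    (hψb : ∀ R : ℝ, ∃ C, ∀ x, |x| ≤ R → |ψ x| ≤ C)
    (hφ : Continuous φ) (hφc : HasCompactSupport φ) (α : ℝ)
    (h0 : ∀ η : ℝ, ∫ t, h t * ψ (α * t + η) ∂ν = 0) (η : ℝ) :
    ∫ t, h t * (φ ⋆[ContinuousLinearMap.lsmul ℝ ℝ, volume] ψ) (α * t + η) ∂ν = 0 := by
  obtain ⟨R, hR⟩ := hφc.isCompact.isBounded.exists_norm_le
  -- This radius contains every argument `α * t + η - y` with `t` in the interval and `y` in the
  -- support of `φ`.
  obtain ⟨C, hC⟩ := hψb (|α| * |u| + |η| + R)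
  have hint : Integrable (Function.uncurry fun (t : TimeInterval u) (y : ℝ) =>
      h t * (φ y * ψ (α * t + η - y))) (ν.prod volume) := by
    have h1 : Integrable (fun z : TimeInterval u × ℝ => C * (h z.1 * φ z.2)) (ν.prod volume) :=
      (hh.mul_prod (hφ.integrable_of_hasCompactSupport hφc)).const_mul C
    refine h1.mono ?_ (ae_of_all _ fun z => ?_)
    · have h2 : AEStronglyMeasurable (fun z : TimeInterval u × ℝ => h z.1) (ν.prod volume) :=
        hh.aestronglyMeasurable.comp_fst
      have h3 : Measurable fun z : TimeInterval u × ℝ => φ z.2 * ψ (α * z.1 + η - z.2) := by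
        have := hφ.measurable
        fun_prop
      exact h2.mul h3.aestronglyMeasurable
    · rcases eq_or_ne (φ z.2) 0 with hz | hz
      · simp [Function.uncurry, hz]
      · have hz2 : |z.2| ≤ R := hR z.2 (subset_closure hz)
        have ht : |(z.1 : ℝ)| ≤ |u| := by
          rw [abs_of_nonneg z.1.2.1]
          exact z.1.2.2.trans (le_abs_self u)
        have hb : |ψ (α * z.1 + η - z.2)| ≤ C := by
          refine hC _ ?_
          calc |α * z.1 + η - z.2| ≤ |α * z.1 + η| + |z.2| := abs_sub _ _
            _ ≤ |α * z.1| + |η| + |z.2| := by gcongr; exact abs_add_le _ _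
            _ ≤ |α| * |u| + |η| + R := by rw [abs_mul]; gcongr
        simp only [Function.uncurry, Real.norm_eq_abs, abs_mul]
        calc |h z.1| * (|φ z.2| * |ψ (α * z.1 + η - z.2)|)
            ≤ |h z.1| * (|φ z.2| * |C|) := by
              gcongr ?_ * (?_ * ?_)
              exact hb.trans (le_abs_self C)
          _ = |C| * (|h z.1| * |φ z.2|) := by ring
  calc ∫ t, h t * (φ ⋆[ContinuousLinearMap.lsmul ℝ ℝ, volume] ψ) (α * t + η) ∂ν
      = ∫ t, (∫ y : ℝ, h t * (φ y * ψ (α * t + η - y))) ∂ν := by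
        simp only [convolution_def, ContinuousLinearMap.lsmul_apply, smul_eq_mul,
          integral_const_mul]
    _ = ∫ y, ∫ t, h t * (φ y * ψ (α * t + η - y)) ∂ν := integral_integral_swap hint
    _ = ∫ y, φ y * ∫ t, h t * ψ (α * t + (η - y)) ∂ν := by
        refine integral_congr_ae (ae_of_all _ fun y => ?_)
        simp only [← integral_const_mul]
        refine integral_congr_ae (ae_of_all _ fun t => ?_)
        simp only [add_sub_assoc]
        ring
    _ = 0 := by simp [h0]

/-- A square integrable function on `[0, u]` all of whose moments vanish is zero. -/
theorem Lp_eq_zero_of_moments_eq_zero {u : ℝ} {ν : Measure (TimeInterval u)} [IsFiniteMeasure ν]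
    (h : Lp ℝ 2 ν) (h0 : ∀ k : ℕ, ∫ t, h t * (t : ℝ) ^ k ∂ν = 0) : h = 0 := by
  have hh : Integrable h ν := (Lp.memLp h).integrable one_le_two
  have hinner : ∀ f : C(TimeInterval u, ℝ),
      inner ℝ (ContinuousMap.toLp 2 ν ℝ f) h = ∫ t, h t * f t ∂ν := by
    intro f
    rw [L2.inner_def]
    refine integral_congr_ae ?_
    filter_upwards [ContinuousMap.coeFn_toLp (p := 2) (𝕜 := ℝ) ν f] with t ht
    rw [ht]
    simp
  have hpoly : ∀ p : Polynomial ℝ, ∫ t : TimeInterval u, h t * p.eval (t : ℝ) ∂ν = 0 := by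
    intro p
    simp only [Polynomial.eval_eq_sum_range, Finset.mul_sum]
    rw [integral_finsetSum]
    · refine Finset.sum_eq_zero fun k _ => ?_
      simp only [mul_left_comm _ (p.coeff k), integral_const_mul, h0, mul_zero]
    · intro k _
      have hc : Continuous fun t : TimeInterval u => p.coeff k * (t : ℝ) ^ k := by fun_prop
      obtain ⟨C, hC⟩ := isCompact_univ.exists_bound_of_continuousOn hc.continuousOn
      exact hh.mul_bdd hc.aestronglyMeasurable (ae_of_all _ fun t => hC t trivial)
  -- Weierstrass extends orthogonality from polynomials to continuous functions; density of the
  -- latter in `Lp ℝ 2 ν` then makes `h` orthogonal to itself.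
  have hall : ∀ f : C(TimeInterval u, ℝ), inner ℝ (ContinuousMap.toLp 2 ν ℝ f) h = 0 := by
    intro f
    have hclosed : IsClosed {f : C(TimeInterval u, ℝ) |
        inner ℝ (ContinuousMap.toLp 2 ν ℝ f) h = 0} :=
      isClosed_eq (by fun_prop) continuous_const
    have hsub : (polynomialFunctions (Set.Icc (0 : ℝ) u) : Set C(TimeInterval u, ℝ)) ⊆
        {f | inner ℝ (ContinuousMap.toLp 2 ν ℝ f) h = 0} := by
      rintro f hf
      rw [polynomialFunctions_coe] at hf
      obtain ⟨p, rfl⟩ := hf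
      rw [Set.mem_ofPred_eq, hinner]
      simpa using hpoly p
    refine closure_minimal hsub hclosed ?_
    rw [← Subalgebra.topologicalClosure_coe, polynomialFunctions_closure_eq_top]
    trivial
  have hv : ∀ v : Lp ℝ 2 ν, inner ℝ v h = 0 := fun v =>
    (ContinuousMap.toLp_denseRange ℝ ν ℝ (p := 2) (by simp)).induction_on v
      (isClosed_eq (by fun_prop) continuous_const) hall
  exact inner_self_eq_zero.1 (hv h)

/-- A locally bounded function that is not a polynomial is discriminatory: only `0` annihilates
the constants and all its dilates and translates. -/
theorem Lp_eq_zero_of_annihilates {u : ℝ} {ν : Measure (TimeInterval u)} [IsFiniteMeasure ν]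
    (h : Lp ℝ 2 ν) {ψ : ℝ → ℝ} (hψ : Measurable ψ)
    (hψb : ∀ R : ℝ, ∃ C, ∀ x, |x| ≤ R → |ψ x| ≤ C)
    (hψp : ¬ ∃ q : Polynomial ℝ, ∀ᵐ x, ψ x = q.eval x)
    (h0 : ∀ α η : ℝ, ∫ t, h t * ψ (α * t + η) ∂ν = 0) : h = 0 := by
  have hh : Integrable h ν := (Lp.memLp h).integrable one_le_two
  have hloc : LocallyIntegrable ψ volume := by
    rw [locallyIntegrable_iff]
    intro K hK
    obtain ⟨R, hR⟩ := hK.isBounded.exists_norm_le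
    obtain ⟨C, hC⟩ := hψb R
    exact Measure.integrableOn_of_bounded hK.measure_lt_top.ne hψ.aestronglyMeasurable
      ((ae_restrict_mem hK.measurableSet).mono fun x hx => hC x (hR x hx))
  refine Lp_eq_zero_of_moments_eq_zero h fun k => ?_
  by_contra hk
  -- The outer radius is a fixed multiple of the inner one: a bounded ratio (here `K := 2`) is what
  -- a.e. convergence of the mollifications of a merely locally integrable function requires.
  let φ : ℕ → ContDiffBump (0 : ℝ) := fun n =>
    ⟨1 / ((n : ℝ) + 1), 2 * (1 / ((n : ℝ) + 1)), by positivity, by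
      have : (0 : ℝ) < 1 / ((n : ℝ) + 1) := by positivity
      linarith⟩
  have hsmooth : ∀ n, ContDiff ℝ (⊤ : ℕ∞)
      ((φ n).normed volume ⋆[ContinuousLinearMap.lsmul ℝ ℝ, volume] ψ) := fun n =>
    (φ n).hasCompactSupport_normed.contDiff_convolution_left _ (φ n).contDiff_normed hloc
  have hzero : ∀ n x, iteratedDeriv k
      ((φ n).normed volume ⋆[ContinuousLinearMap.lsmul ℝ ℝ, volume] ψ) x = 0 := by
    intro n x
    -- At `α = 0` the `k`-th derivative is evaluated at `x` for every `t`, so it leaves the integral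
    -- and multiplies the `k`-th moment.
    have h1 := integral_pow_mul_iteratedDeriv_eq_zero hh (hsmooth n) x
      (fun α => integral_mul_convolution_eq_zero hh hψ hψb (φ n).continuous_normed
        (φ n).hasCompactSupport_normed α (h0 α) x) k 0
    simp only [zero_mul, zero_add, ← mul_assoc, integral_mul_const] at h1
    exact (mul_eq_zero.1 h1).resolve_left hk
  choose p hp hpe using fun n =>
    exists_polynomial_of_iteratedDeriv_eq_zero k (hsmooth n) (hzero n)
  refine hψp (exists_polynomial_of_ae_tendsto hp ?_)
  have hlim : Tendsto (fun n => (φ n).rOut) atTop (𝓝 0) := by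
    have := (tendsto_one_div_add_atTop_nhds_zero_nat (𝕜 := ℝ)).const_mul 2
    rwa [mul_zero] at this
  filter_upwards [ContDiffBump.ae_convolution_tendsto_right_of_locallyIntegrable (K := 2) hlim
    (Eventually.of_forall fun n => le_rfl) hloc] with x hx
  simpa only [hpe] using hx

/-! ### Density of shallow networks in `L²` of a finite measure -/

/-- The linear space of shallow networks with one output neuron. -/
def scalarNetworks (u : ℝ) (ψ : ℝ → ℝ) : Submodule ℝ (TimeInterval u → ℝ) :=
  Submodule.span ℝ (insert (fun _ => 1)
    (Set.range fun (z : ℝ × ℝ) (t : TimeInterval u) => ψ (z.1 * t + z.2)))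

/-- `ψ` has a Borel measurable, locally bounded modification `φ` which is not a polynomial, such
that all non-constant dilates and translates of `ψ` and `φ` agree `ν`-almost everywhere. -/
structure HasRegularModification {u : ℝ} (ν : Measure (TimeInterval u)) (ψ φ : ℝ → ℝ) : Prop where
  measurable : Measurable φ
  locally_bounded : ∀ R : ℝ, ∃ C, ∀ x, |x| ≤ R → |φ x| ≤ C
  not_polynomial : ¬ ∃ q : Polynomial ℝ, ∀ᵐ x, φ x = q.eval x
  ae_eq : ∀ α η : ℝ, α ≠ 0 → ∀ᵐ t : TimeInterval u ∂ν, ψ (α * t + η) = φ (α * t + η)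

/-- Used to pass from `μ` to the measures `diagMeasure π μ i`. -/
theorem HasRegularModification.mono {u : ℝ} {μ ν : Measure (TimeInterval u)} {ψ φ : ℝ → ℝ}
    (h : HasRegularModification μ ψ φ) (hνμ : ν ≪ μ) : HasRegularModification ν ψ φ :=
  ⟨h.measurable, h.locally_bounded, h.not_polynomial, fun α η hα => hνμ.ae_le (h.ae_eq α η hα)⟩

theorem HasRegularModification.memLp {u : ℝ} {ν : Measure (TimeInterval u)} [IsFiniteMeasure ν]
    {ψ φ : ℝ → ℝ} (h : HasRegularModification ν ψ φ) {f : TimeInterval u → ℝ}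
    (hf : f ∈ scalarNetworks u ψ) : MemLp f 2 ν := by
  induction hf using Submodule.span_induction with
  | mem f hf =>
    rcases hf with rfl | ⟨⟨α, η⟩, rfl⟩
    · exact memLp_const 1
    rcases eq_or_ne α 0 with rfl | hα
    · simpa using memLp_const (ψ η)
    obtain ⟨C, hC⟩ := h.locally_bounded (|α| * |u| + |η|)
    have hm : MemLp (fun t : TimeInterval u => φ (α * t + η)) 2 ν := by
      have := h.measurable
      refine MemLp.of_bound
        (Measurable.aestronglyMeasurable (by fun_prop)) C (ae_of_all _ fun t => hC _ ?_)
      have ht : |(t : ℝ)| ≤ |u| := by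
        rw [abs_of_nonneg t.2.1]
        exact t.2.2.trans (le_abs_self u)
      calc |α * t + η| ≤ |α * t| + |η| := abs_add_le _ _
        _ ≤ |α| * |u| + |η| := by rw [abs_mul]; gcongr
    exact hm.ae_eq ((h.ae_eq α η hα).mono fun t ht => ht.symm)
  | zero => exact MemLp.zero
  | add f g _ _ hf hg => exact hf.add hg
  | smul c f _ hf => exact hf.const_smul c

/-- Universal approximation in `L²(ν)`. -/
theorem HasRegularModification.exists_eLpNorm_sub_lt {u : ℝ} {ν : Measure (TimeInterval u)}
    [IsFiniteMeasure ν] {ψ φ : ℝ → ℝ} (h : HasRegularModification ν ψ φ)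
    {f : TimeInterval u → ℝ} (hf : MemLp f 2 ν) {ε : ENNReal} (hε : 0 < ε) :
    ∃ g ∈ scalarNetworks u ψ, eLpNorm (f - g) 2 ν < ε := by
  let L : scalarNetworks u ψ →ₗ[ℝ] Lp ℝ 2 ν :=
    { toFun := fun g => (h.memLp g.2).toLp g
      map_add' := fun g g' => MemLp.toLp_add (h.memLp g.2) (h.memLp g'.2)
      map_smul' := fun c g => MemLp.toLp_const_smul c (h.memLp g.2) }
  -- A subspace of a Hilbert space is dense exactly when its orthogonal complement is trivial.
  have hbot : (LinearMap.range L)ᗮ = ⊥ := by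
    rw [Submodule.eq_bot_iff]
    intro k hk
    have hann : ∀ g ∈ scalarNetworks u ψ, ∫ t, k t * g t ∂ν = 0 := by
      intro g hg
      have h1 := (Submodule.mem_orthogonal _ _).1 hk (L ⟨g, hg⟩) ⟨_, rfl⟩
      rw [L2.inner_def] at h1
      refine (integral_congr_ae ?_).trans h1
      filter_upwards [(h.memLp hg).coeFn_toLp] with t ht
      simp only [L, LinearMap.coe_mk, AddHom.coe_mk]
      rw [ht]
      simp
    refine Lp_eq_zero_of_annihilates k h.measurable h.locally_bounded h.not_polynomial
      fun α η => ?_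
    -- For `α = 0` the values of `ψ` and `φ` at `η` may differ, but only a constant function is
    -- involved, and constants are networks by virtue of the bias.
    rcases eq_or_ne α 0 with rfl | hα
    · have h1 := hann (fun _ => 1) (Submodule.subset_span (Set.mem_insert _ _))
      simp only [mul_one] at h1
      simp [integral_mul_const, h1]
    · refine (integral_congr_ae ((h.ae_eq α η hα).mono fun t ht => ?_)).trans
        (hann _ (Submodule.subset_span (Set.mem_insert_of_mem _ ⟨(α, η), rfl⟩)))
      simp only [ht]
  have hdense : hf.toLp f ∈ closure (LinearMap.range L : Set (Lp ℝ 2 ν)) := by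
    rw [← Submodule.topologicalClosure_coe, Submodule.topologicalClosure_eq_top_iff.2 hbot]
    trivial
  obtain ⟨_, ⟨g, rfl⟩, hg⟩ := EMetric.mem_closure_iff.1 hdense ε hε
  refine ⟨g, g.2, ?_⟩
  rwa [show L g = (h.memLp g.2).toLp g from rfl, Lp.edist_toLp_toLp] at hg

/-! ### Admissible activation functions -/

/-- No modification is needed: a continuous function that is a.e. a polynomial is that polynomial
everywhere, and a bounded polynomial is constant. -/
theorem IsContinuousBoundedNonconstant.hasRegularModification {ψ : ℝ → ℝ}
    (h : IsContinuousBoundedNonconstant ψ) {u : ℝ} (ν : Measure (TimeInterval u)) :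
    HasRegularModification ν ψ ψ := by
  obtain ⟨C, hC⟩ := h.bounded
  refine ⟨h.continuous.measurable, fun _ => ⟨C, fun x _ => hC x⟩, ?_,
    fun _ _ _ => ae_of_all _ fun _ => rfl⟩
  rintro ⟨q, hq⟩
  have heq : ψ = fun x => q.eval x :=
    (Continuous.ae_eq_iff_eq volume h.continuous q.continuous).1 hq
  have hdeg : q.degree ≤ 0 := by
    by_contra! hdeg
    obtain ⟨x, hx⟩ := ((q.abs_tendsto_atTop hdeg).eventually_gt_atTop C).exists
    have := hC x
    rw [heq] at this
    exact absurd this (not_le.2 (by simpa using hx))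
  refine h.nonconstant ⟨q.coeff 0, fun x => ?_⟩
  rw [heq, Polynomial.eq_C_of_degree_le_zero hdeg]
  simp

/-- Set `ψ` to zero on a Borel null set containing its discontinuities. At the remaining points
continuity turns the essential bound into a pointwise one. Affine maps with nonzero slope pull null
sets back to null sets, and absolute continuity transfers this to `ν`. -/
theorem IsLocallyBoundedNonpolynomial.exists_hasRegularModification {ψ : ℝ → ℝ}
    (h : IsLocallyBoundedNonpolynomial ψ) {u : ℝ} {ν : Measure (TimeInterval u)}
    (hν : ν ≪ Measure.comap (Subtype.val : TimeInterval u → ℝ) volume) :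
    ∃ φ, HasRegularModification ν ψ φ := by
  classical
  set N := toMeasurable volume {x | ¬ ContinuousAt ψ x} with hN
  have hNm : MeasurableSet N := measurableSet_toMeasurable _ _
  have hN0 : volume N = 0 := by rw [hN, measure_toMeasurable, h.ae_continuous]
  have hcont : ∀ x ∉ N, ContinuousAt ψ x := by
    intro x hx
    by_contra hc
    exact hx (subset_toMeasurable _ _ hc)
  have hae : ∀ᵐ x, x ∉ N := measure_eq_zero_iff_ae_notMem.1 hN0
  refine ⟨Nᶜ.piecewise ψ 0, ?_, ?_, ?_, ?_⟩
  · exact ContinuousOn.measurable_piecewise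
      (fun x hx => (hcont x hx).continuousWithinAt) continuousOn_const hNm.compl
  · intro R
    -- The enlarged radius makes each `x` with `|x| ≤ R` an interior point, so a violation of the
    -- bound at `x` would persist on a set of positive measure.
    obtain ⟨C, hC⟩ := h.locally_bounded (Metric.closedBall 0 (R + 1)) (isCompact_closedBall _ _)
    refine ⟨max C 0, fun x hx => ?_⟩
    by_cases hxN : x ∈ N
    · simp [Set.piecewise, hxN]
    · simp only [Set.piecewise, Set.mem_compl_iff, hxN, not_false_eq_true, if_true]
      refine le_max_of_le_left ?_
      by_contra! hlt
      have h1 : ∀ᶠ y in 𝓝 x, C < |ψ y| ∧ y ∈ Metric.closedBall (0 : ℝ) (R + 1) := by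
        refine ((hcont x hxN).abs.eventually_const_lt hlt).and ?_
        exact Metric.closedBall_mem_nhds_of_mem (by simpa using lt_of_le_of_lt hx (lt_add_one R))
      rw [ae_restrict_iff' measurableSet_closedBall] at hC
      have h2 : {y | C < |ψ y| ∧ y ∈ Metric.closedBall (0 : ℝ) (R + 1)} ∈ 𝓝 x := h1
      refine (Measure.measure_pos_of_mem_nhds volume h2).ne' ?_
      refine measure_mono_null ?_ hC
      intro y hy hy'
      exact absurd (hy' hy.2) (not_le.2 hy.1)
  · rintro ⟨q, hq⟩
    refine h.not_polynomial ⟨q, ?_⟩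
    filter_upwards [hq, hae] with x hx hxN
    rw [← hx, Set.piecewise_eq_of_mem _ _ _ hxN]
  · intro α η hα
    have hpre : volume ((fun x : ℝ => α * x + η) ⁻¹' N) = 0 := by
      have hcomp : (fun x : ℝ => α * x + η) ⁻¹' N = (α * ·) ⁻¹' ((· + η) ⁻¹' N) := rfl
      rw [hcomp, Real.volume_preimage_mul_left hα, measure_preimage_add_right, hN0, mul_zero]
    have hcomap : ∀ᵐ t : TimeInterval u ∂(Measure.comap (Subtype.val : TimeInterval u → ℝ) volume),
        α * (t : ℝ) + η ∉ N := by
      rw [ae_iff, comap_subtype_coe_apply measurableSet_Icc]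
      refine measure_mono_null ?_ hpre
      rintro _ ⟨t, ht, rfl⟩
      exact not_not.1 ht
    filter_upwards [hν.ae_le hcomap] with t ht
    rw [Set.piecewise_eq_of_mem _ _ _ ht]

/-! ### The density of the covariation is positive semidefinite -/

/-- For `s ≤ t` there are partition sequences of `[0, s]` and `[0, t]` such that the former is an
initial segment of the latter. -/
theorem exists_isPartitionSequence_le {u : ℝ} [Fact (0 < u)] {s t : TimeInterval u} (hst : s ≤ t) :
    ∃ (m m' : ℕ → ℕ) (p : ℕ → ℕ → TimeInterval u), (∀ n, m n ≤ m' n) ∧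
      IsPartitionSequence s m p ∧ IsPartitionSequence t m' p := by
  have hs0 : (0 : ℝ) ≤ s := s.2.1
  have hst' : (0 : ℝ) ≤ t - s := sub_nonneg.2 hst
  -- `n + 1` equal steps from `0` to `s`, then `n + 1` equal steps from `s` to `t`, constant
  -- afterwards. Truncated subtraction keeps the second counter at zero during the first phase.
  let q : ℕ → ℕ → ℝ := fun n k =>
    (s * (min k (n + 1) : ℕ) + (t - s) * (min (k - (n + 1)) (n + 1) : ℕ)) / (n + 1)
  have hq_mono : ∀ n, Monotone (q n) := by
    intro n k l hkl
    simp only [q]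
    gcongr
  have hpos : ∀ n : ℕ, (0 : ℝ) < n + 1 := fun n => by positivity
  have hq_nonneg : ∀ n k, 0 ≤ q n k := by
    intro n k
    have := hpos n
    simp only [q]
    positivity
  have hq_le : ∀ n k, q n k ≤ t := by
    intro n k
    simp only [q]
    rw [div_le_iff₀ (hpos n)]
    have h1 : ((min k (n + 1) : ℕ) : ℝ) ≤ n + 1 := by exact_mod_cast min_le_right _ _
    have h2 : ((min (k - (n + 1)) (n + 1) : ℕ) : ℝ) ≤ n + 1 := by exact_mod_cast min_le_right _ _
    nlinarith
  have hq_s : ∀ n, q n (n + 1) = s := by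
    intro n
    simp only [q]
    rw [div_eq_iff (hpos n).ne']
    simp
  have hq_t : ∀ n, q n (2 * (n + 1)) = t := by
    intro n
    simp only [q]
    rw [div_eq_iff (hpos n).ne', min_eq_right (by omega), min_eq_right (by omega)]
    push_cast
    ring
  have hq_step : ∀ n k, q n (k + 1) - q n k ≤ t / (n + 1) := by
    intro n k
    simp only [q]
    rw [← sub_div]
    gcongr
    have h1 : ((min (k + 1) (n + 1) : ℕ) : ℝ) ≤ (min k (n + 1) : ℕ) + 1 := by
      exact_mod_cast (by omega : min (k + 1) (n + 1) ≤ min k (n + 1) + 1)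
    have h2 : ((min (k + 1 - (n + 1)) (n + 1) : ℕ) : ℝ) ≤ (min (k - (n + 1)) (n + 1) : ℕ) + 1 := by
      exact_mod_cast (by omega : min (k + 1 - (n + 1)) (n + 1) ≤ min (k - (n + 1)) (n + 1) + 1)
    nlinarith
  have hmesh : ∀ ε : ℝ, 0 < ε → ∀ᶠ n in atTop, ∀ k, q n (k + 1) - q n k < ε := by
    intro ε hε
    have h1 : Tendsto (fun n : ℕ => (t : ℝ) / ((n : ℝ) + 1)) atTop (𝓝 0) := by
      have := (tendsto_one_div_add_atTop_nhds_zero_nat (𝕜 := ℝ)).const_mul (t : ℝ)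
      simpa [div_eq_mul_inv] using this
    filter_upwards [h1.eventually_lt_const hε] with n hn k
    exact (hq_step n k).trans_lt hn
  let p : ℕ → ℕ → TimeInterval u := fun n k => ⟨q n k, hq_nonneg n k, (hq_le n k).trans t.2.2⟩
  have hleft : ∀ n, p n 0 = ⊥ := fun n => Subtype.ext (by
    change q n 0 = 0
    simp only [q, Nat.zero_sub, Nat.zero_min]
    simp)
  exact ⟨fun n => n + 1, fun n => 2 * (n + 1), p, fun n => Nat.le_mul_of_pos_left _ two_pos,
    ⟨fun n _ _ h => hq_mono n h, hleft, fun n => Subtype.ext (hq_s n),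
      fun ε hε => (hmesh ε hε).mono fun n hn k _ => hn k⟩,
    ⟨fun n _ _ h => hq_mono n h, hleft, fun n => Subtype.ext (hq_t n),
      fun ε hε => (hmesh ε hε).mono fun n hn k _ => hn k⟩⟩

/-- Finitely many sequences converging in probability to constants converge simultaneously along
suitable indices and sample points. -/
theorem exists_tendsto_of_tendstoInMeasure {Ω ι : Type*} {mΩ : MeasurableSpace Ω} {P : Measure Ω}
    [IsProbabilityMeasure P] [Fintype ι] {f : ι → ℕ → Ω → ℝ} {a : ι → ℝ}
    (h : ∀ i, TendstoInMeasure P (f i) atTop fun _ => a i) :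
    ∃ (n : ℕ → ℕ) (ω : ℕ → Ω), ∀ i, Tendsto (fun N => f i (n N) (ω N)) atTop (𝓝 (a i)) := by
  have key : ∀ ε : ℝ, 0 < ε → ∃ (n : ℕ) (ω : Ω), ∀ i, dist (f i n ω) (a i) < ε := by
    intro ε hε
    have h1 : Tendsto (fun n => ∑ i, P {ω | ε ≤ dist (f i n ω) (a i)}) atTop (𝓝 0) := by
      simpa using tendsto_finsetSum Finset.univ
        fun i _ => tendstoInMeasure_iff_dist.1 (h i) ε hε
    -- Once the probabilities of the bad events sum to less than one, these events cannot cover `Ω`.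
    obtain ⟨n, hn⟩ := (h1.eventually_lt_const one_pos).exists
    by_contra! hcon
    have hcover : (Set.univ : Set Ω) ⊆ ⋃ i, {ω | ε ≤ dist (f i n ω) (a i)} := by
      intro ω _
      obtain ⟨i, hi⟩ := hcon n ω
      exact Set.mem_iUnion.2 ⟨i, hi⟩
    refine hn.not_ge ?_
    calc (1 : ENNReal) = P Set.univ := measure_univ.symm
      _ ≤ P (⋃ i, {ω | ε ≤ dist (f i n ω) (a i)}) := measure_mono hcover
      _ ≤ ∑ i, P {ω | ε ≤ dist (f i n ω) (a i)} := measure_iUnion_fintype_le P _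
  choose n ω hω using fun N : ℕ => key (1 / ((N : ℝ) + 1)) (by positivity)
  refine ⟨n, ω, fun i => ?_⟩
  rw [tendsto_iff_dist_tendsto_zero]
  exact squeeze_zero (fun _ => dist_nonneg) (fun N => (hω N i).le)
    tendsto_one_div_add_atTop_nhds_zero_nat

/-- The quadratic form `x ↦ xᵀ B x`. -/
def quadForm {d : ℕ} (B : Matrix (Fin d) (Fin d) ℝ) (x : Fin d → ℝ) : ℝ :=
  ∑ i, ∑ j, x i * B i j * x j

/-- Along a partition, the quadratic form of the product sums is the sum of the squared increments
of $x^\top M$. A partition of $[0,t]$ extending one of $[0,s]$ only adds squares, and this survives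
the limit. -/
theorem HasDeterministicCovariation.quadForm_mono {Ω : Type*} {mΩ : MeasurableSpace Ω}
    {P : Measure Ω} [IsProbabilityMeasure P] {u : ℝ} [Fact (0 < u)] {d : ℕ}
    {M : TimeInterval u → Ω → EuclideanSpace ℝ (Fin d)}
    {A : TimeInterval u → Matrix (Fin d) (Fin d) ℝ} (hA : HasDeterministicCovariation P M A)
    (x : Fin d → ℝ) : Monotone fun t => quadForm (A t) x := by
  intro s t hst
  obtain ⟨m, m', p, hmm, hs, ht⟩ := exists_isPartitionSequence_le hst
  let S : ℕ → ℕ → Fin d → Fin d → Ω → ℝ := fun l n i j ω => ∑ k ∈ Finset.range l,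
    (M (p n (k + 1)) ω i - M (p n k) ω i) * (M (p n (k + 1)) ω j - M (p n k) ω j)
  -- The Boolean index treats `s` and `t` together, so that both limits are taken along the same
  -- indices and sample points and can be compared.
  obtain ⟨n, ω, hnω⟩ := exists_tendsto_of_tendstoInMeasure (P := P)
    (f := fun (z : Bool × Fin d × Fin d) n ω =>
      S (if z.1 then m n else m' n) n z.2.1 z.2.2 ω)
    (a := fun z => A (if z.1 then s else t) z.2.1 z.2.2) (by
      rintro ⟨b, i, j⟩
      cases b
      · exact (hA i j).tendsto t m' p ht
      · exact (hA i j).tendsto s m p hs)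
  have hsq : ∀ l n ω, ∑ i, ∑ j, x i * S l n i j ω * x j = ∑ k ∈ Finset.range l,
      (∑ i, x i * (M (p n (k + 1)) ω i - M (p n k) ω i)) ^ 2 := by
    intro l n ω
    simp only [S, sq, Finset.sum_mul_sum]
    rw [Finset.sum_comm (s := Finset.range l)]
    refine Finset.sum_congr rfl fun i _ => ?_
    rw [Finset.sum_comm (s := Finset.range l)]
    refine Finset.sum_congr rfl fun j _ => ?_
    rw [Finset.mul_sum, Finset.sum_mul]
    refine Finset.sum_congr rfl fun k _ => ?_
    ring
  have hlim : ∀ b : Bool, Tendsto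
      (fun N => ∑ i, ∑ j, x i * S (if b then m (n N) else m' (n N)) (n N) i j (ω N) * x j) atTop
      (𝓝 (quadForm (A (if b then s else t)) x)) := fun b =>
    tendsto_finsetSum _ fun i _ => tendsto_finsetSum _ fun j _ =>
      ((hnω (b, i, j)).const_mul (x i)).mul_const (x j)
  refine le_of_tendsto_of_tendsto' (hlim true) (hlim false) fun N => ?_
  simp only [hsq]
  exact Finset.sum_le_sum_of_subset_of_nonneg
    (Finset.range_subset_range.2 (by simpa using hmm (n N))) fun _ _ _ => sq_nonneg _

/-- `A` does not depend on the sample point, so an almost sure property of it can be read off at any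
single good point. -/
theorem HasDeterministicCovariation.continuous {Ω : Type*} {mΩ : MeasurableSpace Ω}
    {P : Measure Ω} [IsProbabilityMeasure P] {u : ℝ} [Fact (0 < u)] {d : ℕ}
    {M : TimeInterval u → Ω → EuclideanSpace ℝ (Fin d)}
    {A : TimeInterval u → Matrix (Fin d) (Fin d) ℝ} (hA : HasDeterministicCovariation P M A)
    (i j : Fin d) : Continuous fun t => A t i j :=
  (hA i j).continuous_paths.exists.choose_spec

theorem HasDeterministicCovariation.apply_bot {Ω : Type*} {mΩ : MeasurableSpace Ω}
    {P : Measure Ω} [IsProbabilityMeasure P] {u : ℝ} [Fact (0 < u)] {d : ℕ}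
    {M : TimeInterval u → Ω → EuclideanSpace ℝ (Fin d)}
    {A : TimeInterval u → Matrix (Fin d) (Fin d) ℝ} (hA : HasDeterministicCovariation P M A)
    (i j : Fin d) : A ⊥ i j = 0 :=
  (hA i j).initial.exists.choose_spec

/-- A density of a continuous increasing function is almost everywhere nonnegative. -/
theorem ae_nonneg_of_monotone_setIntegral_Iic {u : ℝ} [Fact (0 < u)]
    {μ : Measure (TimeInterval u)} {q : TimeInterval u → ℝ} (hq : Integrable q μ)
    {F : TimeInterval u → ℝ} (hFm : Monotone F) (hFc : Continuous F) (hF0 : F ⊥ = 0)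
    (hF : ∀ t, F t = ∫ s in Set.Iic t, q s ∂μ) : 0 ≤ᵐ[μ] q := by
  have hu : (0 : ℝ) ≤ u := (Fact.out : 0 < u).le
  have hGc : Continuous fun x : ℝ => F (Set.projIcc 0 u hu x) :=
    hFc.comp continuous_projIcc
  -- `F` is extended to the line by constants; continuity and `F ⊥ = 0` exclude an atom at `0`.
  let G : StieltjesFunction ℝ :=
    { toFun := fun x => F (Set.projIcc 0 u hu x)
      mono' := hFm.comp (Set.monotone_projIcc hu)
      right_continuous' := fun x => hGc.continuousWithinAt }
  let κ : Measure (TimeInterval u) := Measure.comap Subtype.val G.measure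
  have hκ : ∀ t, κ (Set.Iic t) = ENNReal.ofReal (F t) := by
    intro t
    have himage : (Subtype.val '' Set.Iic t : Set ℝ) = Set.Icc 0 (t : ℝ) := by
      ext x
      constructor
      · rintro ⟨y, hy, rfl⟩
        exact ⟨y.2.1, hy⟩
      · rintro ⟨h0, h1⟩
        exact ⟨⟨x, h0, h1.trans t.2.2⟩, h1, rfl⟩
    have h1 : G (t : ℝ) = F t := congrArg F (Set.projIcc_val hu t)
    have h2 : Function.leftLim G (0 : ℝ) = 0 := by
      have h3 : G (0 : ℝ) = 0 := (congrArg F (Set.projIcc_left hu)).trans hF0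
      exact (ContinuousWithinAt.leftLim_eq hGc.continuousWithinAt).trans h3
    rw [comap_subtype_coe_apply measurableSet_Icc, himage, StieltjesFunction.measure_Icc, h1, h2,
      sub_zero]
  let a : Measure (TimeInterval u) := μ.withDensity fun s => ENNReal.ofReal (q s)
  let b : Measure (TimeInterval u) := μ.withDensity fun s => ENNReal.ofReal (-q s)
  have : IsFiniteMeasure a := isFiniteMeasure_withDensity_ofReal hq.2
  have : IsFiniteMeasure b := isFiniteMeasure_withDensity_ofReal hq.neg.2
  have hab : ∀ s, MeasurableSet s → ∫ x in s, q x ∂μ = (a s).toReal - (b s).toReal := by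
    intro s hs
    rw [integral_eq_lintegral_pos_part_sub_lintegral_neg_part hq.integrableOn,
      withDensity_apply _ hs, withDensity_apply _ hs]
  -- On initial intervals $F=a-b$. Written additively, this is an identity of finite measures
  -- determined by those intervals, and it yields $b\le a$ on all measurable sets.
  have hsum : a = κ + b := by
    refine Measure.ext_of_Iic _ _ fun t => ?_
    have h1 := hab (Set.Iic t) measurableSet_Iic
    rw [← hF] at h1
    have h2 : 0 ≤ F t := hF0 ▸ hFm bot_le
    rw [Measure.add_apply, hκ, ← ENNReal.ofReal_toReal (measure_ne_top a _),
      ← ENNReal.ofReal_toReal (measure_ne_top b _), ← ENNReal.ofReal_add h2 ENNReal.toReal_nonneg]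
    congr 1
    linarith
  refine ae_nonneg_of_forall_setIntegral_nonneg hq fun s hs _ => ?_
  rw [hab s hs, sub_nonneg]
  refine ENNReal.toReal_mono (measure_ne_top a s) ?_
  rw [hsum, Measure.add_apply]
  exact le_add_self

/-- The density of the covariation is positive semidefinite almost everywhere. -/
theorem IsCovariationDensity.ae_quadForm_nonneg {Ω : Type*} {mΩ : MeasurableSpace Ω}
    {P : Measure Ω} [IsProbabilityMeasure P] {u : ℝ} [Fact (0 < u)] {d : ℕ}
    {M : TimeInterval u → Ω → EuclideanSpace ℝ (Fin d)}
    {A : TimeInterval u → Matrix (Fin d) (Fin d) ℝ} (hA : HasDeterministicCovariation P M A)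
    {μ : Measure (TimeInterval u)} {π : TimeInterval u → Matrix (Fin d) (Fin d) ℝ}
    (hπ : IsCovariationDensity A μ π) : ∀ᵐ s ∂μ, ∀ x : Fin d → ℝ, 0 ≤ quadForm (π s) x := by
  have hfix : ∀ x : Fin d → ℝ, ∀ᵐ s ∂μ, 0 ≤ quadForm (π s) x := by
    intro x
    have hterm : ∀ i j, Integrable (fun s => x i * π s i j * x j) μ := fun i j =>
      ((hπ.integrable i j).const_mul (x i)).mul_const (x j)
    refine ae_nonneg_of_monotone_setIntegral_Iic (q := fun s => quadForm (π s) x)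
      (F := fun t => quadForm (A t) x) ?_ (hA.quadForm_mono x) ?_ ?_ ?_
    · exact integrable_finsetSum _ fun i _ => integrable_finsetSum _ fun j _ => hterm i j
    · have := hA.continuous
      unfold quadForm
      fun_prop
    · simp [quadForm, hA.apply_bot]
    · intro t
      simp only [quadForm]
      rw [integral_finsetSum _ fun i _ =>
        integrable_finsetSum _ fun j _ => (hterm i j).integrableOn]
      refine Finset.sum_congr rfl fun i _ => ?_
      rw [integral_finsetSum _ fun j _ => (hterm i j).integrableOn]
      refine Finset.sum_congr rfl fun j _ => ?_
      rw [integral_mul_const, integral_const_mul, hπ.eq_integral]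
  -- The exceptional null set depends on `x`; a countable dense set of vectors and continuity of the
  -- quadratic form remove this dependence.
  have hseq : ∀ᵐ s ∂μ, ∀ n, 0 ≤ quadForm (π s) (TopologicalSpace.denseSeq (Fin d → ℝ) n) :=
    ae_all_iff.2 fun n => hfix _
  filter_upwards [hseq] with s hs x
  have hcont : Continuous fun x => quadForm (π s) x := by
    unfold quadForm
    fun_prop
  exact (TopologicalSpace.denseRange_denseSeq (Fin d → ℝ)).induction_on x
    (isClosed_le continuous_const hcont) hs

/-! ### The spaces `Λ²` and `Λ^{2,0}` -/

theorem quadForm_smul {d : ℕ} (B : Matrix (Fin d) (Fin d) ℝ) (c : ℝ) (x : Fin d → ℝ) :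
    quadForm B (c • x) = c ^ 2 * quadForm B x := by
  simp only [quadForm, Finset.mul_sum, Pi.smul_apply, smul_eq_mul]
  refine Finset.sum_congr rfl fun i _ => Finset.sum_congr rfl fun j _ => ?_
  ring

/-- The parallelogram identity, with the nonnegative term for `x - y` dropped. -/
theorem quadForm_add_le {d : ℕ} {B : Matrix (Fin d) (Fin d) ℝ} (hB : ∀ x, 0 ≤ quadForm B x)
    (x y : Fin d → ℝ) : quadForm B (x + y) ≤ 2 * quadForm B x + 2 * quadForm B y := by
  have h : quadForm B (x + y) + quadForm B (x - y) = 2 * quadForm B x + 2 * quadForm B y := by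
    simp only [quadForm, Finset.mul_sum, ← Finset.sum_add_distrib, Pi.add_apply, Pi.sub_apply]
    refine Finset.sum_congr rfl fun i _ => Finset.sum_congr rfl fun j _ => ?_
    ring
  linarith [hB (x - y)]

theorem diag_nonneg_of_quadForm_nonneg {d : ℕ} {B : Matrix (Fin d) (Fin d) ℝ}
    (hB : ∀ x, 0 ≤ quadForm B x) (i : Fin d) : 0 ≤ B i i := by
  simpa [quadForm, Pi.single_apply] using hB (Pi.single i 1)

/-- Positivity on $x_ie_i-x_je_j$ bounds the two cross terms of a pair by its diagonal terms;
summing over all ordered pairs gives twice the claim. Keeping the cross terms together avoids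
assuming `B` symmetric. -/
theorem quadForm_le_sum_diag {d : ℕ} {B : Matrix (Fin d) (Fin d) ℝ}
    (hB : ∀ x, 0 ≤ quadForm B x) (x : Fin d → ℝ) :
    quadForm B x ≤ d * ∑ i, B i i * x i ^ 2 := by
  have hpair : ∀ i j, x i * B i j * x j + x j * B j i * x i ≤ B i i * x i ^ 2 + B j j * x j ^ 2 := by
    intro i j
    rcases eq_or_ne i j with rfl | hij
    · nlinarith
    have h := hB (Pi.single i (x i) - Pi.single j (x j))
    have hexp : quadForm B (Pi.single i (x i) - Pi.single j (x j))
        = B i i * x i ^ 2 + B j j * x j ^ 2 - (x i * B i j * x j + x j * B j i * x i) := by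
      simp only [quadForm, Pi.sub_apply, Pi.single_apply, sub_mul, mul_sub, ite_mul, mul_ite,
        zero_mul, mul_zero, Finset.sum_sub_distrib, Finset.sum_ite_eq',
        Finset.mem_univ, if_true]
      ring
    linarith
  have hsum := Finset.sum_le_sum fun i (_ : i ∈ Finset.univ) =>
    Finset.sum_le_sum fun j (_ : j ∈ Finset.univ) => hpair i j
  simp only [Finset.sum_add_distrib] at hsum
  rw [Finset.sum_comm (f := fun i j => x j * B j i * x i)] at hsum
  simp only [Finset.sum_const, Finset.card_univ, Fintype.card_fin, nsmul_eq_mul,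
    ← Finset.mul_sum] at hsum
  simp only [quadForm]
  linarith

theorem aemeasurable_coord {u : ℝ} {d : ℕ} {μ : Measure (TimeInterval u)}
    {f : TimeInterval u → EuclideanSpace ℝ (Fin d)} (hf : AEMeasurable f μ) (i : Fin d) :
    AEMeasurable (fun s => f s i) μ :=
  (by fun_prop : Measurable fun v : EuclideanSpace ℝ (Fin d) => v i).comp_aemeasurable hf

theorem aemeasurable_of_coord {u : ℝ} {d : ℕ} {μ : Measure (TimeInterval u)}
    {f : TimeInterval u → EuclideanSpace ℝ (Fin d)} (hf : ∀ i, AEMeasurable (fun s => f s i) μ) :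
    AEMeasurable f μ :=
  (WithLp.measurable_toLp 2 (Fin d → ℝ)).comp_aemeasurable (aemeasurable_pi_iff.2 hf)

/-- The squared norm `∫ fᵀ π f dμ` of `Λ²`. -/
noncomputable def lambdaSq {u : ℝ} {d : ℕ} (π : TimeInterval u → Matrix (Fin d) (Fin d) ℝ)
    (μ : Measure (TimeInterval u)) (f : TimeInterval u → EuclideanSpace ℝ (Fin d)) : ENNReal :=
  ∫⁻ s, ENNReal.ofReal (quadForm (π s) (f s).ofLp) ∂μ

/-- Lets all estimates be made for squares, where no triangle inequality for the norm is needed. -/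
theorem lambdaNorm_lt_iff {u : ℝ} {d : ℕ} {π : TimeInterval u → Matrix (Fin d) (Fin d) ℝ}
    {μ : Measure (TimeInterval u)} {f : TimeInterval u → EuclideanSpace ℝ (Fin d)} {ε : ENNReal} :
    lambdaNorm π μ f < ε ↔ lambdaSq π μ f < ε ^ 2 := by
  have h : lambdaNorm π μ f ^ 2 = lambdaSq π μ f := by
    rw [lambdaNorm, ← ENNReal.rpow_natCast, ← ENNReal.rpow_mul]
    norm_num
    rfl
  rw [← h]
  exact (ENNReal.pow_right_strictMono two_ne_zero).lt_iff_lt.symm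

theorem aemeasurable_quadForm {u : ℝ} {d : ℕ} {π : TimeInterval u → Matrix (Fin d) (Fin d) ℝ}
    {μ : Measure (TimeInterval u)} (hπ : ∀ i j, Measurable fun s => π s i j)
    {f : TimeInterval u → EuclideanSpace ℝ (Fin d)} (hf : AEMeasurable f μ) :
    AEMeasurable (fun s => ENNReal.ofReal (quadForm (π s) (f s).ofLp)) μ := by
  refine AEMeasurable.ennreal_ofReal ?_
  refine Finset.aemeasurable_fun_sum _ fun i _ => Finset.aemeasurable_fun_sum _ fun j _ => ?_
  exact ((aemeasurable_coord hf i).mul (hπ i j).aemeasurable).mul (aemeasurable_coord hf j)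

theorem lambdaSq_add_le {u : ℝ} {d : ℕ} {π : TimeInterval u → Matrix (Fin d) (Fin d) ℝ}
    {μ : Measure (TimeInterval u)} (hπ : ∀ i j, Measurable fun s => π s i j)
    (hpos : ∀ᵐ s ∂μ, ∀ x : Fin d → ℝ, 0 ≤ quadForm (π s) x)
    {f : TimeInterval u → EuclideanSpace ℝ (Fin d)} (hf : AEMeasurable f μ)
    (g : TimeInterval u → EuclideanSpace ℝ (Fin d)) :
    lambdaSq π μ (f + g) ≤ 2 * lambdaSq π μ f + 2 * lambdaSq π μ g := by
  simp only [lambdaSq]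
  rw [← lintegral_const_mul' 2 _ (by simp), ← lintegral_const_mul' 2 _ (by simp),
    ← lintegral_add_left' ((aemeasurable_quadForm hπ hf).const_mul 2)]
  refine lintegral_mono_ae (hpos.mono fun s hs => ?_)
  refine (ENNReal.ofReal_le_ofReal (quadForm_add_le hs (f s).ofLp (g s).ofLp)).trans ?_
  rw [ENNReal.ofReal_add (mul_nonneg zero_le_two (hs _)) (mul_nonneg zero_le_two (hs _)),
    ENNReal.ofReal_mul zero_le_two, ENNReal.ofReal_mul zero_le_two, ENNReal.ofReal_ofNat]

theorem lambdaSq_smul {u : ℝ} {d : ℕ} (π : TimeInterval u → Matrix (Fin d) (Fin d) ℝ)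
    (μ : Measure (TimeInterval u)) (c : ℝ) (f : TimeInterval u → EuclideanSpace ℝ (Fin d)) :
    lambdaSq π μ (c • f) = ENNReal.ofReal (c ^ 2) * lambdaSq π μ f := by
  simp only [lambdaSq]
  rw [← lintegral_const_mul' _ _ ENNReal.ofReal_ne_top]
  refine lintegral_congr fun s => ?_
  rw [← ENNReal.ofReal_mul (sq_nonneg c), ← quadForm_smul]
  rfl

/-- The bridge from $\Lambda^2$ to scalar approximation: coordinatewise smallness in
$L^2(\mu_{i,i})$ forces smallness in $\Lambda^2$. -/
theorem lambdaSq_le_sum_eLpNorm {u : ℝ} {d : ℕ}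
    {π : TimeInterval u → Matrix (Fin d) (Fin d) ℝ}
    {μ : Measure (TimeInterval u)} (hπ : ∀ i j, Measurable fun s => π s i j)
    (hpos : ∀ᵐ s ∂μ, ∀ x : Fin d → ℝ, 0 ≤ quadForm (π s) x)
    {f : TimeInterval u → EuclideanSpace ℝ (Fin d)} (hf : AEMeasurable f μ) :
    lambdaSq π μ f ≤ d * ∑ i, eLpNorm (fun s => f s i) 2 (diagMeasure π μ i) ^ 2 := by
  have hterm : ∀ i, AEMeasurable (fun s => ENNReal.ofReal (π s i i) * ‖f s i‖ₑ ^ 2) μ := fun i =>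
    (hπ i i).ennreal_ofReal.aemeasurable.mul ((aemeasurable_coord hf i).enorm.pow_const 2)
  have hnorm : ∀ i, eLpNorm (fun s => f s i) 2 (diagMeasure π μ i) ^ 2
      = ∫⁻ s, ENNReal.ofReal (π s i i) * ‖f s i‖ₑ ^ 2 ∂μ := by
    intro i
    have h := eLpNorm_nnreal_pow_eq_lintegral (f := fun s => f s i) (μ := diagMeasure π μ i)
      (p := 2) two_ne_zero
    norm_num at h
    rw [h, diagMeasure, lintegral_withDensity_eq_lintegral_mul₀
      (hπ i i).ennreal_ofReal.aemeasurable ((aemeasurable_coord hf i).enorm.pow_const 2)]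
    rfl
  simp only [hnorm]
  rw [← lintegral_finsetSum' _ fun i _ => hterm i, ← lintegral_const_mul' _ _ (by simp)]
  refine lintegral_mono_ae (hpos.mono fun s hs => ?_)
  have hd := fun i => diag_nonneg_of_quadForm_nonneg hs i
  calc ENNReal.ofReal (quadForm (π s) (f s).ofLp)
      ≤ ENNReal.ofReal (d * ∑ i, π s i i * f s i ^ 2) :=
        ENNReal.ofReal_le_ofReal (quadForm_le_sum_diag hs _)
    _ = d * ∑ i, ENNReal.ofReal (π s i i) * ‖f s i‖ₑ ^ 2 := by
        rw [ENNReal.ofReal_mul (by positivity), ENNReal.ofReal_natCast,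
          ENNReal.ofReal_sum_of_nonneg fun i _ => mul_nonneg (hd i) (sq_nonneg _)]
        congr 1
        refine Finset.sum_congr rfl fun i _ => ?_
        rw [ENNReal.ofReal_mul (hd i), ← sq_abs, ENNReal.ofReal_pow (abs_nonneg _),
          ← Real.norm_eq_abs, ofReal_norm]

theorem mem_Lambda2_iff {u : ℝ} {d : ℕ} {π : TimeInterval u → Matrix (Fin d) (Fin d) ℝ}
    {μ : Measure (TimeInterval u)} {f : TimeInterval u → EuclideanSpace ℝ (Fin d)} :
    f ∈ Lambda2 π μ ↔ AEMeasurable f μ ∧ lambdaSq π μ f < ⊤ := by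
  change (AEMeasurable f μ ∧ lambdaNorm π μ f < ⊤) ↔ _
  rw [lambdaNorm_lt_iff, ENNReal.top_pow two_ne_zero]

/-- `Λ²` is a linear space. -/
theorem exists_submodule_coe_eq_Lambda2 {u : ℝ} {d : ℕ}
    {π : TimeInterval u → Matrix (Fin d) (Fin d) ℝ}
    {μ : Measure (TimeInterval u)} (hπ : ∀ i j, Measurable fun s => π s i j)
    (hpos : ∀ᵐ s ∂μ, ∀ x : Fin d → ℝ, 0 ≤ quadForm (π s) x) :
    ∃ W : Submodule ℝ (TimeInterval u → EuclideanSpace ℝ (Fin d)),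
      (W : Set (TimeInterval u → EuclideanSpace ℝ (Fin d))) = Lambda2 π μ := by
  refine ⟨⟨⟨⟨Lambda2 π μ, ?_⟩, ?_⟩, ?_⟩, rfl⟩
  · intro f g hf hg
    rw [mem_Lambda2_iff] at hf hg ⊢
    refine ⟨hf.1.add hg.1, (lambdaSq_add_le hπ hpos hf.1 g).trans_lt ?_⟩
    exact ENNReal.add_lt_top.2 ⟨ENNReal.mul_lt_top (by simp) hf.2, ENNReal.mul_lt_top (by simp) hg.2⟩
  · exact mem_Lambda2_iff.2 ⟨aemeasurable_const, by simp [lambdaSq, quadForm]⟩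
  · intro c f hf
    have hf' := mem_Lambda2_iff.1 hf
    refine mem_Lambda2_iff.2 ⟨hf'.1.const_smul c, ?_⟩
    rw [lambdaSq_smul]
    exact ENNReal.mul_lt_top ENNReal.ofReal_lt_top hf'.2

/-- `Λ^{2,0}` is a linear space. -/
theorem exists_submodule_coe_eq_Lambda20 {u : ℝ} {d : ℕ}
    (π : TimeInterval u → Matrix (Fin d) (Fin d) ℝ) (μ : Measure (TimeInterval u)) :
    ∃ W : Submodule ℝ (TimeInterval u → EuclideanSpace ℝ (Fin d)),
      (W : Set (TimeInterval u → EuclideanSpace ℝ (Fin d))) = Lambda20 π μ := by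
  refine ⟨⟨⟨⟨Lambda20 π μ, ?_⟩, ?_⟩, ?_⟩, rfl⟩
  · rintro f g ⟨hf, hf'⟩ ⟨hg, hg'⟩
    exact ⟨hf.add hg, fun i => (hf' i).add (hg' i)⟩
  · exact ⟨aemeasurable_const, fun i => MemLp.zero⟩
  · rintro c f ⟨hf, hf'⟩
    exact ⟨hf.const_smul c, fun i => (hf' i).const_smul c⟩

theorem Lambda20_subset_Lambda2 {u : ℝ} {d : ℕ}
    {π : TimeInterval u → Matrix (Fin d) (Fin d) ℝ}
    {μ : Measure (TimeInterval u)} (hπ : ∀ i j, Measurable fun s => π s i j)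
    (hpos : ∀ᵐ s ∂μ, ∀ x : Fin d → ℝ, 0 ≤ quadForm (π s) x) :
    Lambda20 π μ ⊆ Lambda2 π μ := by
  rintro f ⟨hf, hf'⟩
  refine mem_Lambda2_iff.2 ⟨hf, (lambdaSq_le_sum_eLpNorm hπ hpos hf).trans_lt ?_⟩
  exact ENNReal.mul_lt_top (by simp)
    (ENNReal.sum_lt_top.2 fun i _ => ENNReal.pow_lt_top (hf' i).2)

/-! ### Density of shallow networks -/

/-- A function is a shallow network iff each of its components is one. -/
theorem mem_shallowNetworks_iff {u : ℝ} {d : ℕ} {ψ : ℝ → ℝ}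
    {f : TimeInterval u → EuclideanSpace ℝ (Fin d)} :
    f ∈ shallowNetworks u d ψ ↔ ∀ i, (fun t => f t i) ∈ scalarNetworks u ψ := by
  constructor
  · rintro ⟨m, α, η, w, b, hf⟩ i
    have heq : (fun t => f t i) = (∑ k, w i k • fun t : TimeInterval u => ψ (α k * t + η k))
        + b i • fun _ => (1 : ℝ) := by
      ext t
      simp [hf]
    rw [heq]
    refine Submodule.add_mem _ (Submodule.sum_mem _ fun k _ => ?_) ?_
    · exact Submodule.smul_mem _ _
        (Submodule.subset_span (Set.mem_insert_of_mem _ ⟨(α k, η k), rfl⟩))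
    · exact Submodule.smul_mem _ _ (Submodule.subset_span (Set.mem_insert _ _))
  · intro h
    have hrep : ∀ i, ∃ (b : ℝ) (c : ℝ × ℝ →₀ ℝ), ∀ t : TimeInterval u,
        f t i = c.sum (fun z a => a * ψ (z.1 * t + z.2)) + b := by
      intro i
      obtain ⟨b, g, hg, hfg⟩ := Submodule.mem_span_insert.1 (h i)
      obtain ⟨c, rfl⟩ := Finsupp.mem_span_range_iff_exists_finsupp.1 hg
      refine ⟨b, c, fun t => ?_⟩
      rw [congrFun hfg t, add_comm]
      simp [Finsupp.sum]
    choose b c hc using hrep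
    classical
    -- The components may use different hidden nodes. The network takes the union of all of them,
    -- with weight zero where a component does not use a node.
    let s : Finset (ℝ × ℝ) := Finset.univ.biUnion fun i => (c i).support
    refine ⟨s.card, fun k => (s.equivFin.symm k).1.1, fun k => (s.equivFin.symm k).1.2,
      fun i k => c i (s.equivFin.symm k).1, b, fun t i => ?_⟩
    rw [hc, Finsupp.sum_of_support_subset (s := s) _
      (Finset.subset_biUnion_of_mem (fun i => (c i).support) (Finset.mem_univ i)) _ (by simp),
      ← Finset.sum_coe_sort, ← Equiv.sum_comp s.equivFin.symm]

theorem exists_submodule_coe_eq_shallowNetworks (u : ℝ) (d : ℕ) (ψ : ℝ → ℝ) :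
    ∃ S : Submodule ℝ (TimeInterval u → EuclideanSpace ℝ (Fin d)),
      (S : Set (TimeInterval u → EuclideanSpace ℝ (Fin d))) = shallowNetworks u d ψ := by
  refine ⟨⟨⟨⟨shallowNetworks u d ψ, ?_⟩, ?_⟩, ?_⟩, rfl⟩
  · intro f g hf hg
    rw [mem_shallowNetworks_iff] at hf hg ⊢
    exact fun i => Submodule.add_mem _ (hf i) (hg i)
  · exact mem_shallowNetworks_iff.2 fun i => Submodule.zero_mem _
  · intro c f hf
    exact mem_shallowNetworks_iff.2 fun i =>
      Submodule.smul_mem _ c (mem_shallowNetworks_iff.1 hf i)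

theorem isFiniteMeasure_diagMeasure {u : ℝ} {d : ℕ}
    {π : TimeInterval u → Matrix (Fin d) (Fin d) ℝ} {μ : Measure (TimeInterval u)}
    {i : Fin d} (hπ : Integrable (fun s => π s i i) μ) : IsFiniteMeasure (diagMeasure π μ i) :=
  isFiniteMeasure_withDensity_ofReal hπ.2

theorem shallowNetworks_subset_Lambda20 {u : ℝ} {d : ℕ}
    {π : TimeInterval u → Matrix (Fin d) (Fin d) ℝ} {μ : Measure (TimeInterval u)}
    [IsFiniteMeasure μ] (hπ : ∀ i, Integrable (fun s => π s i i) μ)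
    {ψ φ : ℝ → ℝ} (hψ : HasRegularModification μ ψ φ) :
    shallowNetworks u d ψ ⊆ Lambda20 π μ := by
  intro f hf
  rw [mem_shallowNetworks_iff] at hf
  refine ⟨aemeasurable_of_coord fun i => (hψ.memLp (hf i)).aestronglyMeasurable.aemeasurable,
    fun i => ?_⟩
  have := isFiniteMeasure_diagMeasure (hπ i)
  have hac : diagMeasure π μ i ≪ μ := withDensity_absolutelyContinuous _ _
  exact (hψ.mono hac).memLp (hf i)

/-- Every element of `Λ²` is approximated by its truncations. -/
theorem exists_bounded_lambdaSq_sub_lt {u : ℝ} {d : ℕ}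
    {π : TimeInterval u → Matrix (Fin d) (Fin d) ℝ}
    {μ : Measure (TimeInterval u)} (hπ : ∀ i j, Measurable fun s => π s i j)
    {f : TimeInterval u → EuclideanSpace ℝ (Fin d)} (hf : f ∈ Lambda2 π μ)
    {ε : ENNReal} (hε : 0 < ε) :
    ∃ g : TimeInterval u → EuclideanSpace ℝ (Fin d), AEMeasurable g μ ∧
      (∃ C : ℝ, ∀ s, ‖g s‖ ≤ C) ∧ lambdaSq π μ (f - g) < ε := by
  classical
  obtain ⟨hfm, hfi⟩ := mem_Lambda2_iff.1 hf
  -- The whole vector is set to zero when its norm is large, instead of clipping coordinates. The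
  -- error is then either `0` or `f s` itself, so its quadratic form is dominated by that of `f`.
  let τ : ℕ → EuclideanSpace ℝ (Fin d) → EuclideanSpace ℝ (Fin d) := fun n v =>
    if ‖v‖ ≤ n then v else 0
  have hτ : ∀ n, Measurable (τ n) := fun n =>
    Measurable.ite (measurableSet_le measurable_norm measurable_const) measurable_id
      measurable_const
  have hm : ∀ n, AEMeasurable (fun s => τ n (f s)) μ := fun n => (hτ n).comp_aemeasurable hfm
  have hlim : Tendsto (fun n => lambdaSq π μ (f - fun s => τ n (f s))) atTop
      (𝓝 (∫⁻ _, 0 ∂μ)) := by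
    refine tendsto_lintegral_of_dominated_convergence'
      (fun s => ENNReal.ofReal (quadForm (π s) (f s).ofLp))
      (fun n => aemeasurable_quadForm hπ (hfm.sub (hm n)))
      (fun n => ae_of_all _ fun s => ?_) hfi.ne (ae_of_all _ fun s => ?_)
    · by_cases h : ‖f s‖ ≤ n
      · simp [τ, h, quadForm]
      · simp [τ, h]
    · refine tendsto_const_nhds.congr' ?_
      obtain ⟨N, hN⟩ := exists_nat_ge ‖f s‖
      filter_upwards [eventually_ge_atTop N] with n hn
      have h : ‖f s‖ ≤ n := hN.trans (by exact_mod_cast hn)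
      simp [τ, h, quadForm]
  rw [lintegral_zero] at hlim
  obtain ⟨n, hn⟩ := (hlim.eventually_lt_const hε).exists
  refine ⟨_, hm n, ⟨n, fun s => ?_⟩, hn⟩
  by_cases h : ‖f s‖ ≤ n
  · simp [τ, h]
  · simp [τ, h]

/-- Truncation comes first: a bounded function has its coordinates in every $L^2(\mu_{i,i})$,
because these measures are finite, and the scalar theorem applies to each. -/
theorem exists_shallowNetworks_lambdaNorm_sub_lt {u : ℝ} {d : ℕ}
    {π : TimeInterval u → Matrix (Fin d) (Fin d) ℝ} {μ : Measure (TimeInterval u)}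
    [IsFiniteMeasure μ] (hπm : ∀ i j, Measurable fun s => π s i j)
    (hπ : ∀ i, Integrable (fun s => π s i i) μ)
    (hpos : ∀ᵐ s ∂μ, ∀ x : Fin d → ℝ, 0 ≤ quadForm (π s) x)
    {ψ φ : ℝ → ℝ} (hψ : HasRegularModification μ ψ φ)
    {f : TimeInterval u → EuclideanSpace ℝ (Fin d)} (hf : f ∈ Lambda2 π μ)
    {ε : ENNReal} (hε : 0 < ε) :
    ∃ g ∈ shallowNetworks u d ψ, lambdaNorm π μ (f - g) < ε := by
  have hε2 : 0 < ε ^ 2 / 2 := ENNReal.div_pos (pow_ne_zero 2 hε.ne') (by simp)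
  obtain ⟨k, hkm, ⟨C, hC⟩, hk⟩ := exists_bounded_lambdaSq_sub_lt hπm hf
    (ENNReal.div_pos hε2.ne' (by simp : (2 : ENNReal) ≠ ⊤))
  -- One factor `d` comes from `lambdaSq_le_sum_eLpNorm`, the other from summing over `d`
  -- coordinates, and the `2` from `lambdaSq_add_le`.
  obtain ⟨δ, hδ, hδ0⟩ : ∃ δ : ENNReal, 2 * (d * (d * δ ^ 2)) < ε ^ 2 / 2 ∧ 0 < δ := by
    have hlim : Tendsto (fun δ : ENNReal => 2 * (d * (d * δ ^ 2))) (𝓝 0) (𝓝 0) := by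
      have h1 : Tendsto (fun δ : ENNReal => δ ^ 2) (𝓝 0) (𝓝 0) := by
        simpa using (ENNReal.continuous_pow 2).tendsto 0
      have h2 := ENNReal.Tendsto.const_mul (a := 2) (ENNReal.Tendsto.const_mul (a := (d : ENNReal))
        (ENNReal.Tendsto.const_mul (a := (d : ENNReal)) h1 (by simp)) (by simp)) (by simp)
      simpa using h2
    exact (((hlim.mono_left nhdsWithin_le_nhds).eventually_lt_const hε2).and
      (self_mem_nhdsWithin (s := Set.Ioi 0))).exists
  have happrox : ∀ i, ∃ g ∈ scalarNetworks u ψ,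
      eLpNorm ((fun s => k s i) - g) 2 (diagMeasure π μ i) < δ := by
    intro i
    have := isFiniteMeasure_diagMeasure (hπ i)
    have hac : diagMeasure π μ i ≪ μ := withDensity_absolutelyContinuous _ _
    refine (hψ.mono hac).exists_eLpNorm_sub_lt (MemLp.of_bound
      ((aemeasurable_coord hkm i).mono_ac hac).aestronglyMeasurable C
      (ae_of_all _ fun s => (PiLp.norm_apply_le (k s) i).trans (hC s))) hδ0
  choose g hg hgδ using happrox
  let G : TimeInterval u → EuclideanSpace ℝ (Fin d) := fun t => WithLp.toLp 2 fun i => g i t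
  have hG : G ∈ shallowNetworks u d ψ := mem_shallowNetworks_iff.2 hg
  have hGm : AEMeasurable G μ := (shallowNetworks_subset_Lambda20 hπ hψ hG).1
  refine ⟨G, hG, lambdaNorm_lt_iff.2 ?_⟩
  have hkG : lambdaSq π μ (k - G) ≤ d * (d * δ ^ 2) := by
    refine (lambdaSq_le_sum_eLpNorm hπm hpos (hkm.sub hGm)).trans ?_
    gcongr
    calc ∑ i, eLpNorm (fun s => (k - G) s i) 2 (diagMeasure π μ i) ^ 2
        ≤ ∑ _i : Fin d, δ ^ 2 := by
          gcongr with i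
          exact (hgδ i).le
      _ = d * δ ^ 2 := by simp
  calc lambdaSq π μ (f - G) = lambdaSq π μ ((f - k) + (k - G)) := by rw [sub_add_sub_cancel]
    _ ≤ 2 * lambdaSq π μ (f - k) + 2 * lambdaSq π μ (k - G) :=
        lambdaSq_add_le hπm hpos ((mem_Lambda2_iff.1 hf).1.sub hkm) _
    _ < ε ^ 2 / 2 + ε ^ 2 / 2 := by
        refine ENNReal.add_lt_add ?_ ((mul_le_mul_right hkG 2).trans_lt hδ)
        rwa [mul_comm, ← ENNReal.lt_div_iff_mul_lt (by simp) (by simp)]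
    _ = ε ^ 2 := ENNReal.add_halves _

theorem IsLebesgueStieltjes.isFiniteMeasure {u : ℝ} [Fact (0 < u)] {F : TimeInterval u → ℝ}
    {μ : Measure (TimeInterval u)} (h : IsLebesgueStieltjes F μ) : IsFiniteMeasure μ := by
  refine ⟨?_⟩
  rw [← Set.Iic_top, h]
  exact ENNReal.ofReal_lt_top

theorem mainTheorem5 {Ω : Type*} {mΩ : MeasurableSpace Ω} (P : Measure Ω) [IsProbabilityMeasure P]
    (u : ℝ) [Fact (0 < u)] (d : ℕ)
    (ℱ : Filtration (TimeInterval u) mΩ)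
    (hℱ : ∀ t s, MeasurableSet s → P s = 0 → MeasurableSet[ℱ t] s)
    (M : TimeInterval u → Ω → EuclideanSpace ℝ (Fin d))
    (hM : IsContinuousLocalMartingale P ℱ M)
    (A : TimeInterval u → Matrix (Fin d) (Fin d) ℝ)
    (hA : HasDeterministicCovariation P M A)
    (hA_pos : 0 < (A ⊤).trace)
    (μ : Measure (TimeInterval u)) (hμ : IsLebesgueStieltjes (fun t => (A t).trace) μ)
    (π : TimeInterval u → Matrix (Fin d) (Fin d) ℝ) (hπ : IsCovariationDensity A μ π)
    (ψ : ℝ → ℝ)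
    (hψ : IsContinuousBoundedNonconstant ψ ∨
      (IsLocallyBoundedNonpolynomial ψ ∧ μ ≪ Measure.comap (Subtype.val : TimeInterval u → ℝ) volume)) :
    IsDenseLinearSubspace π μ (shallowNetworks u d ψ) (Lambda20 π μ) ∧
      IsDenseLinearSubspace π μ (shallowNetworks u d ψ) (Lambda2 π μ) := by
  have := hμ.isFiniteMeasure
  have hpos := hπ.ae_quadForm_nonneg hA
  obtain ⟨φ, hφ⟩ : ∃ φ, HasRegularModification μ ψ φ := by
    rcases hψ with hψ | ⟨hψ, hac⟩
    · exact ⟨ψ, hψ.hasRegularModification μ⟩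
    · exact hψ.exists_hasRegularModification hac
  have hsub := Lambda20_subset_Lambda2 hπ.measurable hpos
  have hnet := shallowNetworks_subset_Lambda20 (fun i => hπ.integrable i i) hφ
  obtain ⟨S, hS⟩ := exists_submodule_coe_eq_shallowNetworks u d ψ
  obtain ⟨W, hW⟩ := exists_submodule_coe_eq_Lambda2 hπ.measurable hpos
  obtain ⟨W₀, hW₀⟩ := exists_submodule_coe_eq_Lambda20 π μ
  have hdense : ∀ f ∈ Lambda2 π μ, ∀ ε : ENNReal, 0 < ε →
      ∃ g ∈ shallowNetworks u d ψ, lambdaNorm π μ (f - g) < ε := fun f hf ε hε =>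
    exists_shallowNetworks_lambdaNorm_sub_lt hπ.measurable (fun i => hπ.integrable i i) hpos hφ
      hf hε
  -- Both spaces carry the same norm, so density in $\Lambda^{2,0}$ is the restriction of the
  -- approximation property of $\Lambda^2$.
  refine ⟨⟨⟨S, W₀, hS, hW₀, ?_⟩, fun f hf => hdense f (hsub hf)⟩,
    ⟨⟨S, W, hS, hW, ?_⟩, hdense⟩⟩
  · rw [← SetLike.coe_subset_coe, hS, hW₀]
    exact hnet
  · rw [← SetLike.coe_subset_coe, hS, hW]
    exact hnet.trans hsub
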